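/- Let $k\ge 1$ be an integer. For every integer $d\ge k+2$ let \[ B_{d,k}(z)=\sum_{i=0}^{k} a_i\,z^{d-k+i},\qquad a_i=\frac{(-1)^i\,d(d-1)\cdots(d-k)}{i!\,(k-i)!\,(d-k+i)}\qquad(0\le i\le k) \] be the conservative dynamical Belyi polynomial (the $a_i$ depend on $d$ and $k$), choose any $\beta=\beta_d\in\overline{\mathbb Q}$ with $\beta^{d-1}=a_k$, and let \[ B^{\varphi}_{d,k}=\varphi^{-1}\circ B_{d,k}\circ\varphi,\qquad \varphi(z)=\tfrac1\beta z, \] that is, $B^{\varphi}_{d,k}(z)=\sum_{i=0}^{k}\frac{a_i}{\beta^{d-k+i-1}}\,z^{d-k+i}$, a monic polynomial of degree $d$. For a polynomial $f(z)=c\prod_{i=1}^{d}(z-\alpha_i)\in\overline{\mathbb Q}[z]$ of degree $d\ge 1$ let $h(f)=\frac1d\sum_{i=1}^d h(\alpha_i)$, where $h(\alpha)$ is the absolute logarithmic Weil height of the algebraic number $\alpha$. Then, for every such choice of the $\beta_d$, \[ \lim_{d\to\infty}\frac{h\big(B^{\varphi}_{d,k}\big)}{\frac1d\log d}=k . \]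 -/

import Mathlib

open Polynomial Filter Topology

noncomputable section

namespace ConservativeBelyi

/-- The coefficient `a_i = (-1)^i d (d-1) ⋯ (d-k) / (i! (k-i)! (d-k+i))` of the conservative
dynamical Belyi polynomial `B_{d,k}`, for `0 ≤ i ≤ k` and `1 ≤ k ≤ d - 2`. -/
def belyiCoeff (d k i : ℕ) : ℚ :=
  ((-1) ^ i * ∏ j ∈ Finset.range (k + 1), ((d : ℚ) - j)) /
    (i.factorial * (k - i).factorial * ((d : ℚ) - k + i))

/-- The conservative dynamical Belyi polynomial `B_{d,k}(z) = ∑_{i=0}^k a_i z^{d-k+i}`, for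
`1 ≤ k ≤ d - 2`, over the field of algebraic numbers. -/
def belyi (d k : ℕ) : (AlgebraicClosure ℚ)[X] :=
  ∑ i ∈ Finset.range (k + 1),
    C (algebraMap ℚ (AlgebraicClosure ℚ) (belyiCoeff d k i)) * X ^ (d - k + i)

/-- The conjugate `f^φ = φ⁻¹ ∘ f ∘ φ` of a polynomial `f` by the affine map `φ(z) = a z + b`,
where `a ≠ 0`, so that `φ⁻¹(w) = a⁻¹ (w - b)`. -/
def affineConj (a b : AlgebraicClosure ℚ) (f : (AlgebraicClosure ℚ)[X]) :
    (AlgebraicClosure ℚ)[X] :=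
  C a⁻¹ * (f.comp (C a * X + C b) - C b)

/-- The conjugate of `B_{d,k}` by the scaling map `φ(z) = z / β`; it is monic when
`β ^ (d - 1) = a_k`. -/
def belyiConj (d k : ℕ) (β : AlgebraicClosure ℚ) : (AlgebraicClosure ℚ)[X] :=
  affineConj β⁻¹ 0 (belyi d k)

/-- The height of a nonconstant polynomial `f = c ∏ (z - α_i)` of degree `d` with algebraic
coefficients: the average `(1/d) ∑ h(α_i)` of the absolute logarithmic heights of its roots,
counted with multiplicity. -/
def polyHeight (f : (AlgebraicClosure ℚ)[X]) : ℝ :=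
  (1 / (f.natDegree : ℝ)) * (f.roots.map fun α => NumberField.absLogHeight₁ α).sum

end ConservativeBelyi

end

/-! Put n = d - k. Then k! B_{d,k} = z^n P with P = `intPoly n k` integral of degree k. The n zero
roots have height 0, so only the k roots of P matter. By Gauss's lemma and the product formula, the
heights of the roots of P add up to log M(P), M being the Mahler measure, minus the normalized
log-norm of the content ideal (`prod_mulHeight₁_roots_mul_absNorm`). The content divides k!, since
the coefficients of P sum to k! (`sum_intCoeff`), and M(P) lies between n^k and 2^k (n+k)^k. Hence
the sum is k log d + O_k(1). Conjugation multiplies each root by β, and h(β) = h(a_k)/(d-1) is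
bounded in terms of k (`absLogHeight₁_le_of_pow_eq`), so it moves the sum by O_k(1) only. Dividing
by log d gives the limit k. -/

namespace NumberField

open Height Module

/-! ### Heights under extension of number fields. -/

section Embeddings

variable {K : Type*} [Field K] [NumberField K]

theorem InfinitePlace.prod_pow_mult_eq_prod_embeddings {M : Type*} [CommMonoid M]
    (f : InfinitePlace K → M) :
    ∏ w : InfinitePlace K, f w ^ w.mult = ∏ φ : K →+* ℂ, f (InfinitePlace.mk φ) := by
  classical
  rw [← Finset.prod_fiberwise Finset.univ InfinitePlace.mk (fun φ => f (InfinitePlace.mk φ))]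
  refine Finset.prod_congr rfl fun w _ => ?_
  rw [Finset.prod_congr rfl (g := fun _ => f w)
    (fun φ hφ => by rw [(Finset.mem_filter.mp hφ).2]), Finset.prod_const,
    InfinitePlace.card_filter_mk_eq]

/-- The extensions of an embedding φ to `L` are the `K`-algebra maps from `L` to ℂ, of which there
are `finrank K L`. -/
theorem prod_embeddings_comp_algebraMap {L : Type*} [Field L] [NumberField L] [Algebra K L]
    {M : Type*} [CommMonoid M] (f : (K →+* ℂ) → M) :
    ∏ ψ : L →+* ℂ, f (ψ.comp (algebraMap K L)) = (∏ φ : K →+* ℂ, f φ) ^ finrank K L := by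
  classical
  rw [← Finset.prod_fiberwise Finset.univ (fun ψ : L →+* ℂ => ψ.comp (algebraMap K L)),
    ← Finset.prod_pow]
  refine Finset.prod_congr rfl fun φ _ => ?_
  rw [Finset.prod_congr rfl (g := fun _ => f φ)
    (fun ψ hψ => by rw [(Finset.mem_filter.mp hψ).2]), Finset.prod_const]
  congr 1
  let _ : Algebra K ℂ := φ.toAlgebra
  rw [← AlgHom.card K L ℂ, ← Fintype.card_subtype]
  refine (Fintype.card_congr
    { toFun := fun σ => ⟨σ.toRingHom, σ.comp_algebraMap⟩
      invFun := fun ψ => { ψ.1 with commutes' := fun x => RingHom.congr_fun ψ.2 x }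
      left_inv := fun _ => rfl
      right_inv := fun _ => rfl }).symm

/-- The height of a nonzero tuple of algebraic integers as a product over the embeddings,
divided by the norm of the ideal generated by the tuple. -/
theorem mulHeight_mul_absNorm_span {ι : Type*} [Finite ι] {x : ι → 𝓞 K} (hx : x ≠ 0) :
    mulHeight (fun i => (x i : K)) * (Ideal.span (Set.range x)).absNorm =
      ∏ φ : K →+* ℂ, ⨆ i, ‖φ (x i)‖ := by
  have hx' : (fun i => (x i : K)) ≠ 0 := by
    obtain ⟨i, hi⟩ := Function.ne_iff.mp hx
    exact Function.ne_iff.mpr ⟨i, by simpa using hi⟩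
  rw [mulHeight_eq hx', mul_assoc, mul_comm (∏ᶠ _, _),
    absNorm_mul_finprod_finitePlace_eq_one hx, mul_one,
    InfinitePlace.prod_pow_mult_eq_prod_embeddings (fun v => ⨆ i, v (x i : K))]
  simp

variable {L : Type*} [Field L] [NumberField L] [Algebra K L]

theorem finrank_ringOfIntegers : finrank (𝓞 K) (𝓞 L) = finrank K L :=
  (IsFractionRing.finrank_eq (𝓞 K) K (𝓞 L) L).symm

/-- Both the product over embeddings and the norm of the generated ideal are raised to the power [L
: K], so their quotient is too; finite places need not be compared. -/
theorem mulHeight_algebraMap_integers {ι : Type*} [Finite ι] {x : ι → 𝓞 K} (hx : x ≠ 0) :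
    mulHeight (fun i => algebraMap K L (x i)) =
      mulHeight (fun i => (x i : K)) ^ finrank K L := by
  set y : ι → 𝓞 L := fun i => algebraMap (𝓞 K) (𝓞 L) (x i) with hy_def
  have hyx (i : ι) : (y i : L) = algebraMap K L (x i) :=
    (IsScalarTower.algebraMap_apply (𝓞 K) (𝓞 L) L (x i)).symm.trans
      (IsScalarTower.algebraMap_apply (𝓞 K) K L (x i))
  have hy : y ≠ 0 := by
    obtain ⟨i, hi⟩ := Function.ne_iff.mp hx
    refine Function.ne_iff.mpr ⟨i, ?_⟩
    simpa [hy_def] using hi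
  have hspan : Ideal.span (Set.range y) = (Ideal.span (Set.range x)).map (algebraMap _ _) := by
    rw [Ideal.map_span, ← Set.range_comp]
    rfl
  have hN : ((Ideal.span (Set.range y)).absNorm : ℝ) ≠ 0 := by
    obtain ⟨i, hi⟩ := Function.ne_iff.mp hy
    rw [Nat.cast_ne_zero, Ne, Ideal.absNorm_eq_zero_iff]
    intro h
    exact hi (by simpa [h] using Ideal.subset_span (s := Set.range y) ⟨i, rfl⟩)
  refine mul_right_cancel₀ hN ?_
  have h1 := mulHeight_mul_absNorm_span hy
  simp only [hyx] at h1
  rw [h1, hspan, Ideal.absNorm_algebraMap, finrank_ringOfIntegers (K := K) (L := L), Nat.cast_pow,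
    ← mul_pow, mulHeight_mul_absNorm_span hx, ← prod_embeddings_comp_algebraMap]
  rfl

/-- The behaviour of the multiplicative height under an extension of number fields. -/
theorem mulHeight₁_algebraMap (x : K) :
    mulHeight₁ (algebraMap K L x) = mulHeight₁ x ^ finrank K L := by
  obtain ⟨a, b, hb, rfl⟩ := IsFractionRing.div_surjective (𝓞 K) x
  have hb0 : b ≠ 0 := nonZeroDivisors.ne_zero hb
  have hx : ![a, b] ≠ 0 := by simp [hb0]
  have h := mulHeight_algebraMap_integers (L := L) hx
  rw [map_div₀, mulHeight₁_div_eq_mulHeight, mulHeight₁_div_eq_mulHeight]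
  convert h using 2
  · ext i; fin_cases i <;> rfl
  · congr 1; ext i; fin_cases i <;> rfl

end Embeddings

open IntermediateField in
/-- The absolute height may be computed in any number field. -/
theorem finrank_mul_absLogHeight₁ {Ω : Type*} [Field Ω] [CharZero Ω] {L : Type*} [Field L]
    [NumberField L] [Algebra L Ω] (y : L) :
    finrank ℚ L * absLogHeight₁ (algebraMap L Ω y) = logHeight₁ y := by
  have hy : IsIntegral ℚ (algebraMap L Ω y) :=
    (Algebra.IsIntegral.isIntegral (R := ℚ) y).algebraMap
  rw [absLogHeight₁, absMulHeight₁, dif_pos hy]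
  set F := ℚ⟮algebraMap L Ω y⟯
  have : FiniteDimensional ℚ F := adjoin.finiteDimensional hy
  have : NumberField F := {}
  let f : L →ₐ[ℚ] Ω := (algebraMap L Ω).toRatAlgHom
  have hF : F ≤ f.fieldRange := by
    rw [adjoin_le_iff, Set.singleton_subset_iff]
    exact ⟨y, rfl⟩
  let e : L ≃ₐ[ℚ] f.fieldRange := AlgEquiv.ofInjectiveField f
  -- The absolute height is defined through the field generated by the image of `y`; `g` makes `L`
  -- an extension of that field, with the generator going to `y`.
  let g : F →ₐ[ℚ] L := e.symm.toAlgHom.comp (inclusion hF)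
  have hg : g (AdjoinSimple.gen ℚ (algebraMap L Ω y)) = y := by
    apply e.injective
    simp only [g]
    refine (e.apply_symm_apply _).trans ?_
    ext
    rfl
  let _ : Algebra F L := g.toRingHom.toAlgebra
  have h := mulHeight₁_algebraMap (L := L) (AdjoinSimple.gen ℚ (algebraMap L Ω y))
  have hg' : algebraMap F L (AdjoinSimple.gen ℚ (algebraMap L Ω y)) = y := hg
  rw [hg'] at h
  rw [logHeight₁, h, Real.log_pow, Real.log_rpow (mulHeight₁_pos _), ← mul_assoc]
  congr 1
  have h2 : finrank ℚ F * finrank F L = finrank ℚ L := finrank_mul_finrank ℚ F L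
  have h3 : (finrank ℚ F : ℝ) ≠ 0 := by exact_mod_cast finrank_pos.ne'
  rw [← h2, Nat.cast_mul, mul_right_comm, mul_inv_cancel₀ h3, one_mul]

/-! ### The absolute height on an algebraic extension of ℚ. -/

section Absolute

variable {Ω : Type*} [Field Ω] [CharZero Ω]

theorem absLogHeight₁_algebraMap_eq {L : Type*} [Field L] [NumberField L] [Algebra L Ω] (y : L) :
    absLogHeight₁ (algebraMap L Ω y) = logHeight₁ y / finrank ℚ L := by
  have : (finrank ℚ L : ℝ) ≠ 0 := by exact_mod_cast finrank_pos.ne'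
  rw [← finrank_mul_absLogHeight₁ (Ω := Ω) y, mul_div_cancel_left₀ _ this]

theorem exists_numberField_of_finite [Algebra.IsAlgebraic ℚ Ω] (s : Set Ω) (hs : s.Finite) :
    ∃ L : IntermediateField ℚ Ω, NumberField L ∧ s ⊆ L := by
  have : FiniteDimensional ℚ (IntermediateField.adjoin ℚ s) :=
    have := hs.to_subtype
    IntermediateField.finiteDimensional_adjoin fun x _ => Algebra.IsIntegral.isIntegral x
  exact ⟨IntermediateField.adjoin ℚ s, {}, IntermediateField.subset_adjoin ℚ s⟩

variable [Algebra.IsAlgebraic ℚ Ω]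

theorem absLogHeight₁_pow (x : Ω) (n : ℕ) : absLogHeight₁ (x ^ n) = n * absLogHeight₁ x := by
  obtain ⟨L, hL, hs⟩ := exists_numberField_of_finite {x} (Set.finite_singleton x)
  lift x to L using hs rfl
  have h := absLogHeight₁_algebraMap_eq (Ω := Ω) (x ^ n)
  have h' := absLogHeight₁_algebraMap_eq (Ω := Ω) x
  rw [map_pow] at h
  rw [IntermediateField.algebraMap_apply] at h h'
  rw [h, h', logHeight₁_pow, mul_div_assoc]

theorem absLogHeight₁_mul_le (x y : Ω) :
    absLogHeight₁ (x * y) ≤ absLogHeight₁ x + absLogHeight₁ y := by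
  obtain ⟨L, hL, hs⟩ := exists_numberField_of_finite {x, y} (by simp)
  lift x to L using hs (by simp)
  lift y to L using hs (by simp)
  have h := absLogHeight₁_algebraMap_eq (Ω := Ω) (x * y)
  have hx := absLogHeight₁_algebraMap_eq (Ω := Ω) x
  have hy := absLogHeight₁_algebraMap_eq (Ω := Ω) y
  rw [map_mul] at h
  rw [IntermediateField.algebraMap_apply] at hx hy
  rw [IntermediateField.algebraMap_apply, IntermediateField.algebraMap_apply] at h
  rw [h, hx, hy, ← add_div]
  gcongr
  exact logHeight₁_mul_le x y

theorem absLogHeight₁_inv (x : Ω) : absLogHeight₁ x⁻¹ = absLogHeight₁ x := by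
  obtain ⟨L, hL, hs⟩ := exists_numberField_of_finite {x} (Set.finite_singleton x)
  lift x to L using hs rfl
  have h := absLogHeight₁_algebraMap_eq (Ω := Ω) x⁻¹
  have h' := absLogHeight₁_algebraMap_eq (Ω := Ω) x
  rw [map_inv₀] at h
  rw [IntermediateField.algebraMap_apply] at h h'
  rw [h, h', logHeight₁_inv]

theorem abs_absLogHeight₁_mul_sub_le {x : Ω} (hx : x ≠ 0) (y : Ω) :
    |absLogHeight₁ (x * y) - absLogHeight₁ y| ≤ absLogHeight₁ x := by
  have h1 := absLogHeight₁_mul_le x y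
  have h2 := absLogHeight₁_mul_le x⁻¹ (x * y)
  rw [inv_mul_cancel_left₀ hx, absLogHeight₁_inv] at h2
  rw [abs_le]
  constructor <;> linarith

omit [Algebra.IsAlgebraic ℚ Ω] in
theorem absLogHeight₁_ratCast (q : ℚ) :
    absLogHeight₁ (q : Ω) = logHeight₁ q := by
  rw [← eq_ratCast (algebraMap ℚ Ω) q, absLogHeight₁_algebraMap_eq, finrank_self, Nat.cast_one, div_one]

end Absolute

end NumberField

/-! ### Local factors of a split polynomial: Gauss norm and Mahler measure. -/

namespace Polynomial

theorem gaussNorm_eq_iSup_fin {R : Type*} [Ring R] (v : AbsoluteValue R ℝ) (p : R[X]) {n : ℕ}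
    (hn : p.natDegree ≤ n) :
    p.gaussNorm v 1 = ⨆ i : Fin (n + 1), v (p.coeff i) := by
  refine le_antisymm ?_ (ciSup_le fun i => by simpa using p.le_gaussNorm v zero_le_one i)
  obtain ⟨i, hi⟩ := p.exists_eq_gaussNorm v 1
  rw [hi, one_pow, mul_one]
  by_cases h : i ≤ n
  · exact Finite.le_ciSup_of_le (⟨i, Nat.lt_succ_of_le h⟩ : Fin (n + 1)) le_rfl
  · rw [coeff_eq_zero_of_natDegree_lt (by omega), map_zero]
    exact Real.iSup_nonneg fun _ => v.nonneg _

theorem gaussNorm_X_sub_C {R : Type*} [Ring R] [Nontrivial R] (v : AbsoluteValue R ℝ)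
    (hv : v 1 = 1) (a : R) : (X - C a).gaussNorm v 1 = max (v a) 1 := by
  rw [gaussNorm_eq_iSup_fin v _ (natDegree_X_sub_C a).le]
  refine le_antisymm (ciSup_le fun i => ?_) (max_le ?_ ?_)
  · fin_cases i <;> simp [coeff_X, hv]
  · exact Finite.le_ciSup_of_le (0 : Fin 2) (by simp)
  · exact Finite.le_ciSup_of_le (1 : Fin 2) (by simp [coeff_X, hv])

/-- Gauss's lemma: the Gauss norm of a split polynomial in terms of its roots. -/
theorem Splits.gaussNorm_eq {K : Type*} [Field K] {v : AbsoluteValue K ℝ}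
    (hna : IsNonarchimedean v) {p : K[X]} (hp : p.Splits) :
    p.gaussNorm v 1 = v p.leadingCoeff * (p.roots.map fun a => max (v a) 1).prod := by
  have key (s : Multiset K) : (s.map fun a => X - C a).prod.gaussNorm v 1 =
      (s.map fun a => max (v a) 1).prod := by
    induction s using Multiset.induction with
    | empty => simpa using gaussNorm_C v 1 (1 : K)
    | cons a s ih =>
      rw [Multiset.map_cons, Multiset.prod_cons, gaussNorm_mul hna one_pos, ih,
        gaussNorm_X_sub_C v v.map_one, Multiset.map_cons, Multiset.prod_cons]
  conv_lhs => rw [hp.eq_prod_roots]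
  rw [gaussNorm_mul hna one_pos, gaussNorm_C, key]

theorem Splits.mahlerMeasure_map {K : Type*} [Field K] {p : K[X]} (hp : p.Splits) (φ : K →+* ℂ) :
    (p.map φ).mahlerMeasure =
      ‖φ p.leadingCoeff‖ * (p.roots.map fun a => max ‖φ a‖ 1).prod := by
  rw [mahlerMeasure_eq_leadingCoeff_mul_prod_roots, leadingCoeff_map, hp.roots_map,
    Multiset.map_map]
  simp only [Function.comp_def, max_comm]

end Polynomial

/-! ### Heights of the roots of an integer polynomial. -/

namespace NumberField

open Height Module

variable {K : Type*} [Field K] [NumberField K]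

theorem FinitePlace.isNonarchimedean (v : FinitePlace K) : IsNonarchimedean v.val :=
  FinitePlace.add_le v

theorem FinitePlace.hasFiniteMulSupport_max_one (a : K) :
    (fun v : FinitePlace K => max (v a) 1).HasFiniteMulSupport := by
  rcases eq_or_ne a 0 with rfl | ha
  · simp [Function.HasFiniteMulSupport]
  · exact (FinitePlace.hasFiniteMulSupport ha).max Function.hasFiniteMulSupport_fun_one

theorem FinitePlace.hasFiniteMulSupport_prod_max_one (s : Multiset K) :
    (fun v : FinitePlace K => (s.map fun a => max (v a) 1).prod).HasFiniteMulSupport := by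
  induction s using Multiset.induction with
  | empty => simp [Function.HasFiniteMulSupport]
  | cons a s ih =>
    simpa only [Multiset.map_cons, Multiset.prod_cons] using!
      (FinitePlace.hasFiniteMulSupport_max_one a).mul ih

theorem prod_mulHeight₁_eq (s : Multiset K) :
    (s.map mulHeight₁).prod = (∏ φ : K →+* ℂ, (s.map fun a => max ‖φ a‖ 1).prod) *
      ∏ᶠ v : FinitePlace K, (s.map fun a => max (v a) 1).prod := by
  induction s using Multiset.induction with
  | empty => simp
  | cons a s ih =>
    simp only [Multiset.map_cons, Multiset.prod_cons]
    rw [ih, Finset.prod_mul_distrib, finprod_mul_distrib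
      (FinitePlace.hasFiniteMulSupport_max_one a) (FinitePlace.hasFiniteMulSupport_prod_max_one s),
      mul_mul_mul_comm, mulHeight₁_eq,
      InfinitePlace.prod_pow_mult_eq_prod_embeddings fun v => max (v a) 1]
    simp

/-- Each local factor on the right carries an extra absolute value of the leading coefficient; these
cancel by the product formula. -/
theorem prod_mulHeight₁_roots {p : K[X]} (hp : p.Splits) (hp0 : p ≠ 0) :
    (p.roots.map mulHeight₁).prod = (∏ φ : K →+* ℂ, (p.map φ).mahlerMeasure) *
      ∏ᶠ v : FinitePlace K, p.gaussNorm v.val 1 := by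
  have hc : p.leadingCoeff ≠ 0 := leadingCoeff_ne_zero.mpr hp0
  have h1 : (∏ᶠ v : FinitePlace K, p.gaussNorm v.val 1) =
      (∏ᶠ v : FinitePlace K, v p.leadingCoeff) *
        ∏ᶠ v : FinitePlace K, (p.roots.map fun a => max (v a) 1).prod := by
    rw [← finprod_mul_distrib (FinitePlace.hasFiniteMulSupport hc)
      (FinitePlace.hasFiniteMulSupport_prod_max_one _)]
    exact finprod_congr fun v => hp.gaussNorm_eq v.isNonarchimedean
  have h2 := prod_abs_eq_one hc
  rw [InfinitePlace.prod_pow_mult_eq_prod_embeddings fun v => v p.leadingCoeff] at h2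
  simp only [InfinitePlace.apply] at h2
  simp only [hp.mahlerMeasure_map, Finset.prod_mul_distrib, h1]
  rw [mul_mul_mul_comm, h2, one_mul, prod_mulHeight₁_eq]

/-- The heights of the roots of an integer polynomial in terms of its Mahler measure and of its
content ideal. -/
theorem prod_mulHeight₁_roots_mul_absNorm {P : ℤ[X]} (hP : P ≠ 0)
    (hs : (P.map (Int.castRingHom K)).Splits) :
    ((P.map (Int.castRingHom K)).roots.map mulHeight₁).prod *
      (Ideal.span (Set.range fun i : Fin (P.natDegree + 1) => (P.coeff i : 𝓞 K))).absNorm =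
      (P.map (Int.castRingHom ℂ)).mahlerMeasure ^ finrank ℚ K := by
  have hP' : P.map (Int.castRingHom K) ≠ 0 :=
    (Polynomial.map_ne_zero_iff (RingHom.injective_int _)).mpr hP
  have hx : (fun i : Fin (P.natDegree + 1) => (P.coeff i : 𝓞 K)) ≠ 0 := by
    refine Function.ne_iff.mpr ⟨Fin.last _, ?_⟩
    simpa using hP
  rw [prod_mulHeight₁_roots hs hP', mul_assoc]
  have h1 : (∏ᶠ v : FinitePlace K, (P.map (Int.castRingHom K)).gaussNorm v.val 1) =
      ∏ᶠ v : FinitePlace K, ⨆ i : Fin (P.natDegree + 1), v ((P.coeff i : 𝓞 K) : K) := by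
    refine finprod_congr fun v => ?_
    rw [gaussNorm_eq_iSup_fin _ _ natDegree_map_le]
    simp
    rfl
  rw [h1, mul_comm (∏ᶠ _, _), absNorm_mul_finprod_finitePlace_eq_one hx, mul_one]
  simp only [Polynomial.map_map]
  rw [Finset.prod_congr rfl (g := fun _ => (P.map (Int.castRingHom ℂ)).mahlerMeasure)
    (fun φ _ => by rw [RingHom.eq_intCast' (φ.comp _)]), Finset.prod_const, Finset.card_univ,
    Embeddings.card]

variable {Ω : Type*} [Field Ω] [CharZero Ω] [Algebra.IsAlgebraic ℚ Ω]

/-- In a number field L containing the roots, the norm of the content ideal divides m^[L:ℚ]. After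
division by [L : ℚ] it costs at most log m, whatever L is. -/
theorem sum_absLogHeight₁_roots_mem_Icc {P : ℤ[X]} (hP : P ≠ 0)
    (hs : (P.map (Int.castRingHom Ω)).Splits) {m : ℕ} (hm : m ≠ 0)
    (hmP : (m : ℤ) ∈ Ideal.span (Set.range fun i : Fin (P.natDegree + 1) => P.coeff i)) :
    ((P.map (Int.castRingHom Ω)).roots.map absLogHeight₁).sum ∈
      Set.Icc (Real.log (P.map (Int.castRingHom ℂ)).mahlerMeasure - Real.log m)
        (Real.log (P.map (Int.castRingHom ℂ)).mahlerMeasure) := by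
  classical
  obtain ⟨L, hL, hsub⟩ := exists_numberField_of_finite
    {x : Ω | x ∈ (P.map (Int.castRingHom Ω)).roots} (Multiset.finite_toSet _)
  have hmap : P.map (Int.castRingHom Ω) = (P.map (Int.castRingHom L)).map (algebraMap L Ω) := by
    rw [Polynomial.map_map]
    congr 1
  have hsL : (P.map (Int.castRingHom L)).Splits := by
    rw [hmap] at hs hsub
    exact Splits.of_splits_map (algebraMap L Ω) hs fun a ha => ⟨⟨a, hsub ha⟩, rfl⟩
  have hD : (0 : ℝ) < finrank ℚ L := by exact_mod_cast finrank_pos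
  set I := Ideal.span (Set.range fun i : Fin (P.natDegree + 1) => (P.coeff i : 𝓞 L)) with hI
  have hmI : (m : 𝓞 L) ∈ I := by
    have h := Ideal.mem_map_of_mem (Int.castRingHom (𝓞 L)) hmP
    rw [Ideal.map_span, ← Set.range_comp] at h
    simpa [hI, Function.comp_def] using h
  have hdvd : I.absNorm ∣ m ^ finrank ℚ L := by
    rw [← RingOfIntegers.rank, ← Ideal.absNorm_span_natCast]
    exact Ideal.absNorm_dvd_absNorm_of_le ((Ideal.span_singleton_le_iff_mem _).mpr hmI)
  have hmpos : 0 < m ^ finrank ℚ L := pow_pos (Nat.pos_of_ne_zero hm) _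
  have hN1 : 1 ≤ I.absNorm := Nat.pos_of_dvd_of_pos hdvd hmpos
  have hN2 : I.absNorm ≤ m ^ finrank ℚ L := Nat.le_of_dvd hmpos hdvd
  have hN1' : (1 : ℝ) ≤ I.absNorm := by exact_mod_cast hN1
  have hlog1 : 0 ≤ Real.log I.absNorm := Real.log_nonneg hN1'
  have hlog2 : Real.log I.absNorm ≤ finrank ℚ L * Real.log m := by
    rw [← Real.log_pow]
    exact Real.log_le_log (by linarith) (by exact_mod_cast hN2)
  have hsum : ((P.map (Int.castRingHom Ω)).roots.map absLogHeight₁).sum =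
      Real.log ((P.map (Int.castRingHom L)).roots.map mulHeight₁).prod / finrank ℚ L := by
    rw [hmap, hsL.roots_map, Multiset.map_map, Real.log_multiset_prod, Multiset.map_map,
      div_eq_mul_inv, ← Multiset.sum_map_mul_right]
    · congr 1
      refine Multiset.map_congr rfl fun y _ => ?_
      exact (absLogHeight₁_algebraMap_eq y).trans (div_eq_mul_inv _ _)
    · intro a ha
      obtain ⟨y, -, rfl⟩ := Multiset.mem_map.mp ha
      exact mulHeight₁_ne_zero y
  have hprod := congrArg Real.log (prod_mulHeight₁_roots_mul_absNorm hP hsL)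
  rw [Real.log_mul _ (by linarith), Real.log_pow] at hprod
  · rw [hsum, Set.mem_Icc, le_div_iff₀ hD, div_le_iff₀ hD]
    constructor <;> nlinarith
  · refine Multiset.prod_ne_zero fun h => ?_
    obtain ⟨y, -, hy⟩ := Multiset.mem_map.mp h
    exact mulHeight₁_ne_zero y hy

end NumberField

/-! ### Iterated differences of 1/x, and roots after scaling. -/

theorem fwdDiff_iter_inv (k : ℕ) {x : ℚ} (hx : 0 < x) :
    (fwdDiff 1)^[k] (fun y : ℚ => y⁻¹) x =
      (-1) ^ k * k.factorial / ∏ j ∈ Finset.range (k + 1), (x + j) := by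
  induction k generalizing x with
  | zero => simp
  | succ k ih =>
    have hpos (y : ℚ) (hy : 0 < y) (m : ℕ) : ∏ j ∈ Finset.range m, (y + j) ≠ 0 :=
      (Finset.prod_pos fun j _ => by positivity).ne'
    have h1 : ∏ j ∈ Finset.range (k + 1 + 1), (x + j) =
        (∏ j ∈ Finset.range (k + 1), (x + j)) * (x + k + 1) := by
      rw [Finset.prod_range_succ]
      push_cast
      ring
    have h2 : ∏ j ∈ Finset.range (k + 1 + 1), (x + j) =
        (∏ j ∈ Finset.range (k + 1), (x + 1 + j)) * x := by
      rw [Finset.prod_range_succ']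
      simp [add_comm, add_left_comm]
    have hA := hpos x hx (k + 1)
    have hB := hpos (x + 1) (by linarith) (k + 1)
    rw [Function.iterate_succ_apply', fwdDiff, ih hx, ih (by linarith : (0 : ℚ) < x + 1)]
    have hxk : x + k + 1 ≠ 0 := by positivity
    rw [h1] at h2 ⊢
    set A := ∏ j ∈ Finset.range (k + 1), (x + j)
    set B := ∏ j ∈ Finset.range (k + 1), (x + 1 + j)
    -- The products based at x and x + 1 differ only in their end factors.
    have hB' : B = A * (x + k + 1) / x := by
      rw [h2]; field_simp
    rw [hB', Nat.factorial_succ]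
    push_cast
    field_simp
    ring

namespace Polynomial

theorem roots_comp_C_mul_X {F : Type*} [Field F] {a : F} (ha : a ≠ 0) (f : F[X]) :
    (f.comp (C a * X)).roots = f.roots.map (a⁻¹ * ·) := by
  classical
  ext x
  have h := rootMultiplicity_comp_C_mul_X_add_C f a 0 x ha.isUnit
  rw [C_0, add_zero, add_zero] at h
  rw [count_roots, h, ← count_roots]
  conv_rhs => rw [← inv_mul_cancel_left₀ ha x]
  exact (Multiset.count_map_eq_count' _ _ (mul_right_injective₀ (inv_ne_zero ha)) _).symm

end Polynomial

/-! ### Height estimates for the Belyi polynomials. -/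

namespace ConservativeBelyi

open NumberField Height

instance isAlgebraic_algebraicClosure_rat : Algebra.IsAlgebraic ℚ (AlgebraicClosure ℚ) := by
  rw [Subsingleton.elim (DivisionRing.toRatAlgebra : Algebra ℚ (AlgebraicClosure ℚ))
    (AlgebraicClosure.instAlgebra ℚ)]
  exact AlgebraicClosure.isAlgebraic ℚ

/-- The coefficients of `k! ∑ a_i z^i`, where the `a_i` are the coefficients of `B_{n+k,k}`. -/
def intCoeff (n k i : ℕ) : ℤ :=
  (-1) ^ i * ((k.choose i * ∏ j ∈ (Finset.range (k + 1)).erase i, (n + j) : ℕ) : ℤ)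

/-- The integral polynomial `k! z^{-n} B_{n+k,k}(z)`. -/
noncomputable def intPoly (n k : ℕ) : ℤ[X] :=
  ∑ i ∈ Finset.range (k + 1), C (intCoeff n k i) * X ^ i

theorem coeff_intPoly (n k i : ℕ) :
    (intPoly n k).coeff i = if i ≤ k then intCoeff n k i else 0 := by
  simp [intPoly, coeff_X_pow]

theorem intCoeff_self_ne_zero {n : ℕ} (hn : 0 < n) (k : ℕ) : intCoeff n k k ≠ 0 := by
  refine mul_ne_zero (pow_ne_zero _ (by norm_num)) ?_
  rw [Nat.choose_self, one_mul, Nat.cast_ne_zero, Finset.prod_ne_zero_iff]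
  intro j _
  omega

theorem natDegree_intPoly {n : ℕ} (hn : 0 < n) (k : ℕ) : (intPoly n k).natDegree = k := by
  refine natDegree_eq_of_le_of_coeff_ne_zero ?_ ?_
  · rw [natDegree_le_iff_coeff_eq_zero]
    intro i hi
    rw [coeff_intPoly, if_neg (by omega)]
  · rw [coeff_intPoly, if_pos le_rfl]
    exact intCoeff_self_ne_zero hn k

theorem intPoly_ne_zero {n : ℕ} (hn : 0 < n) (k : ℕ) : intPoly n k ≠ 0 := by
  intro h
  have := coeff_intPoly n k k
  rw [h, if_pos le_rfl, coeff_zero] at this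
  exact intCoeff_self_ne_zero hn k this.symm

theorem abs_intCoeff (n k i : ℕ) :
    |(intCoeff n k i : ℝ)| = k.choose i * ∏ j ∈ (Finset.range (k + 1)).erase i, ((n : ℝ) + j) := by
  rw [intCoeff]
  push_cast
  rw [abs_mul, abs_pow, abs_neg, abs_one, one_pow, one_mul, abs_of_nonneg (by positivity)]

theorem abs_intCoeff_le {n k i : ℕ} (hi : i ≤ k) :
    |(intCoeff n k i : ℝ)| ≤ k.choose i * ((n : ℝ) + k) ^ k := by
  rw [abs_intCoeff]
  gcongr
  refine (Finset.prod_le_prod (g := fun _ => (n : ℝ) + k) (fun _ _ => by positivity)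
    fun j hj => ?_).trans_eq ?_
  · have : j ≤ k := by
      have := Finset.mem_of_mem_erase hj
      rw [Finset.mem_range] at this
      omega
    gcongr
  · rw [Finset.prod_const, Finset.card_erase_of_mem (Finset.mem_range.mpr (by omega)),
      Finset.card_range, Nat.add_sub_cancel]

theorem pow_le_abs_intCoeff_self (n k : ℕ) : (n : ℝ) ^ k ≤ |(intCoeff n k k : ℝ)| := by
  rw [abs_intCoeff, Nat.choose_self, Nat.cast_one, one_mul]
  calc (n : ℝ) ^ k = ∏ j ∈ (Finset.range (k + 1)).erase k, (n : ℝ) := by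
        rw [Finset.prod_const, Finset.card_erase_of_mem (Finset.mem_range.mpr (by omega)),
          Finset.card_range, Nat.add_sub_cancel]
    _ ≤ _ := Finset.prod_le_prod (fun _ _ => by positivity) fun j _ => by simp

/-- Divided by n(n+1)⋯(n+k), the sum is, up to the sign (-1)^k, the k-th forward difference of 1/x
at n. -/
theorem sum_intCoeff {n : ℕ} (hn : 0 < n) (k : ℕ) :
    ∑ i ∈ Finset.range (k + 1), intCoeff n k i = k.factorial := by
  have hn' : (0 : ℚ) < n := by exact_mod_cast hn
  have h := fwdDiff_iter_inv k hn'
  have hP : ∏ j ∈ Finset.range (k + 1), ((n : ℚ) + j) ≠ 0 :=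
    (Finset.prod_pos fun j _ => by positivity).ne'
  rw [fwdDiff_iter_eq_sum_shift, eq_div_iff hP, Finset.sum_mul] at h
  have h2 : (-1 : ℚ) ^ k * ∑ i ∈ Finset.range (k + 1), (intCoeff n k i : ℚ) =
      (-1) ^ k * k.factorial := by
    rw [← h, Finset.mul_sum]
    refine Finset.sum_congr rfl fun i hi => ?_
    rw [← Finset.mul_prod_erase _ _ hi, intCoeff]
    have hni : (n : ℚ) + i ≠ 0 := by positivity
    have hik : i ≤ k := Nat.lt_succ_iff.mp (Finset.mem_range.mp hi)
    have hsgn : (-1 : ℚ) ^ k * (-1) ^ i = (-1) ^ (k - i) := by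
      obtain ⟨m, rfl⟩ := Nat.exists_eq_add_of_le hik
      rw [Nat.add_sub_cancel_left, pow_add, mul_right_comm, ← mul_pow]
      simp
    simp only [nsmul_eq_mul, mul_one, zsmul_eq_mul]
    push_cast
    rw [← hsgn]
    field_simp
  have h3 := mul_left_cancel₀ (pow_ne_zero k (by norm_num : (-1 : ℚ) ≠ 0)) h2
  exact_mod_cast h3

theorem belyiCoeff_eq {n : ℕ} (hn : 0 < n) {k i : ℕ} (hi : i ≤ k) :
    belyiCoeff (n + k) k i = intCoeff n k i / k.factorial := by
  have h1 : ∏ j ∈ Finset.range (k + 1), (((n + k : ℕ) : ℚ) - j) =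
      ∏ j ∈ Finset.range (k + 1), ((n : ℚ) + j) := by
    rw [← Finset.prod_range_reflect]
    refine Finset.prod_congr rfl fun j hj => ?_
    have : j ≤ k := Nat.lt_succ_iff.mp (Finset.mem_range.mp hj)
    rw [Nat.add_sub_cancel, Nat.cast_sub this]
    push_cast
    ring
  have hni : (n : ℚ) + i ≠ 0 := by positivity
  rw [belyiCoeff, h1, ← Finset.mul_prod_erase _ _ (Finset.mem_range.mpr (Nat.lt_succ_of_le hi)),
    intCoeff]
  have hk : (k.factorial : ℚ) ≠ 0 := by positivity
  have hi' : (i.factorial : ℚ) ≠ 0 := by positivity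
  have hki : ((k - i).factorial : ℚ) ≠ 0 := by positivity
  push_cast [Nat.cast_choose ℚ hi]
  rw [add_sub_cancel_right]
  field_simp

theorem belyi_eq {n : ℕ} (hn : 0 < n) (k : ℕ) :
    belyi (n + k) k = C (algebraMap ℚ (AlgebraicClosure ℚ) (k.factorial : ℚ)⁻¹) *
      (X ^ n * (intPoly n k).map (Int.castRingHom (AlgebraicClosure ℚ))) := by
  rw [belyi, intPoly, Polynomial.map_sum, Finset.mul_sum, Finset.mul_sum]
  refine Finset.sum_congr rfl fun i hi => ?_
  rw [belyiCoeff_eq hn (Nat.lt_succ_iff.mp (Finset.mem_range.mp hi)), Nat.add_sub_cancel,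
    div_eq_inv_mul, map_mul, C_mul, pow_add]
  simp only [Polynomial.map_mul, Polynomial.map_pow, map_X, map_intCast, eq_intCast,
    Polynomial.map_intCast]
  ring

theorem belyiConj_eq (d k : ℕ) (β : AlgebraicClosure ℚ) :
    belyiConj d k β = C β * (belyi d k).comp (C β⁻¹ * X) := by
  simp [belyiConj, affineConj]

theorem roots_belyiConj {n : ℕ} (hn : 0 < n) (k : ℕ) {β : AlgebraicClosure ℚ} (hβ : β ≠ 0) :
    (belyiConj (n + k) k β).roots = Multiset.replicate n 0 +
      ((intPoly n k).map (Int.castRingHom (AlgebraicClosure ℚ))).roots.map (β * ·) := by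
  have hP : (intPoly n k).map (Int.castRingHom (AlgebraicClosure ℚ)) ≠ 0 :=
    (Polynomial.map_ne_zero_iff (RingHom.injective_int _)).mpr (intPoly_ne_zero hn k)
  have hc : algebraMap ℚ (AlgebraicClosure ℚ) (k.factorial : ℚ)⁻¹ ≠ 0 := by
    rw [Ne, map_eq_zero]
    positivity
  rw [belyiConj_eq, roots_C_mul _ hβ, roots_comp_C_mul_X (inv_ne_zero hβ), belyi_eq hn,
    roots_C_mul _ hc, roots_mul (mul_ne_zero (pow_ne_zero _ X_ne_zero) hP), roots_X_pow,
    Multiset.map_add, inv_inv, Multiset.map_nsmul, Multiset.map_singleton, mul_zero,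
    Multiset.nsmul_singleton]

theorem card_roots_intPoly {n : ℕ} (hn : 0 < n) (k : ℕ) :
    ((intPoly n k).map (Int.castRingHom (AlgebraicClosure ℚ))).roots.card = k := by
  rw [← (IsAlgClosed.splits _).natDegree_eq_card_roots,
    natDegree_map_eq_of_injective (RingHom.injective_int _), natDegree_intPoly hn]

theorem natDegree_belyiConj {n : ℕ} (hn : 0 < n) (k : ℕ) {β : AlgebraicClosure ℚ} (hβ : β ≠ 0) :
    (belyiConj (n + k) k β).natDegree = n + k := by
  rw [(IsAlgClosed.splits _).natDegree_eq_card_roots, roots_belyiConj hn k hβ, Multiset.card_add,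
    Multiset.card_replicate, Multiset.card_map, card_roots_intPoly hn]

theorem polyHeight_belyiConj {n : ℕ} (hn : 0 < n) (k : ℕ) {β : AlgebraicClosure ℚ} (hβ : β ≠ 0) :
    polyHeight (belyiConj (n + k) k β) = 1 / ((n + k : ℕ) : ℝ) *
      (((intPoly n k).map (Int.castRingHom (AlgebraicClosure ℚ))).roots.map
        fun γ => absLogHeight₁ (β * γ)).sum := by
  have h0 : absLogHeight₁ (0 : AlgebraicClosure ℚ) = 0 := by
    simpa using absLogHeight₁_ratCast (Ω := AlgebraicClosure ℚ) 0
  rw [polyHeight, natDegree_belyiConj hn k hβ, roots_belyiConj hn k hβ, Multiset.map_add,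
    Multiset.sum_add, Multiset.map_replicate, h0, Multiset.sum_replicate, smul_zero, zero_add,
    Multiset.map_map]
  rfl

theorem factorial_mem_span_coeff_intPoly {n : ℕ} (hn : 0 < n) (k : ℕ) :
    (k.factorial : ℤ) ∈ Ideal.span
      (Set.range fun i : Fin ((intPoly n k).natDegree + 1) => (intPoly n k).coeff i) := by
  rw [← sum_intCoeff hn k]
  refine Ideal.sum_mem _ fun i hi => Ideal.subset_span ?_
  rw [Finset.mem_range] at hi
  exact ⟨⟨i, by rwa [natDegree_intPoly hn]⟩, by simp [coeff_intPoly, Nat.lt_succ_iff.mp hi]⟩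

theorem mahlerMeasure_intPoly_le {n : ℕ} (hn : 0 < n) (k : ℕ) :
    ((intPoly n k).map (Int.castRingHom ℂ)).mahlerMeasure ≤ 2 ^ k * ((n : ℝ) + k) ^ k := by
  refine (mahlerMeasure_le_sum_norm_coeff _).trans ?_
  rw [sum_over_range' _ (by simp) (k + 1)
    (Nat.lt_succ_of_le (natDegree_map_le.trans (natDegree_intPoly hn k).le))]
  calc _ ≤ ∑ i ∈ Finset.range (k + 1), (k.choose i : ℝ) * ((n : ℝ) + k) ^ k := by
        refine Finset.sum_le_sum fun i hi => ?_
        have hik : i ≤ k := Nat.lt_succ_iff.mp (Finset.mem_range.mp hi)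
        rw [coeff_map, coeff_intPoly, if_pos hik, eq_intCast, Complex.norm_intCast]
        exact abs_intCoeff_le hik
    _ = 2 ^ k * ((n : ℝ) + k) ^ k := by
        rw [← Finset.sum_mul]
        congr 1
        exact_mod_cast Nat.sum_range_choose k

theorem pow_le_mahlerMeasure_intPoly {n : ℕ} (hn : 0 < n) (k : ℕ) :
    (n : ℝ) ^ k ≤ ((intPoly n k).map (Int.castRingHom ℂ)).mahlerMeasure := by
  refine (pow_le_abs_intCoeff_self n k).trans ?_
  refine le_of_eq_of_le ?_ (leadingCoeff_le_mahlerMeasure _)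
  rw [leadingCoeff, natDegree_map_eq_of_injective (RingHom.injective_int _),
    natDegree_intPoly hn, coeff_map, coeff_intPoly, if_pos le_rfl, eq_intCast,
    Complex.norm_intCast]

theorem abs_sum_absLogHeight₁_roots_intPoly_sub_le {n : ℕ} (hn : 0 < n) (k : ℕ) :
    |(((intPoly n k).map (Int.castRingHom (AlgebraicClosure ℚ))).roots.map absLogHeight₁).sum
      - k * Real.log (n + k)| ≤
      k * Real.log 2 + k * Real.log (k + 1) + Real.log k.factorial := by
  obtain ⟨h1, h2⟩ := sum_absLogHeight₁_roots_mem_Icc (Ω := AlgebraicClosure ℚ)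
    (intPoly_ne_zero hn k) (IsAlgClosed.splits _) k.factorial_ne_zero
    (factorial_mem_span_coeff_intPoly hn k)
  have hn' : (1 : ℝ) ≤ n := by exact_mod_cast hn
  have hlow := Real.log_le_log (by positivity) (pow_le_mahlerMeasure_intPoly hn k)
  have hup := Real.log_le_log (lt_of_lt_of_le (by positivity) (pow_le_mahlerMeasure_intPoly hn k))
    (mahlerMeasure_intPoly_le hn k)
  rw [Real.log_pow] at hlow
  rw [Real.log_mul (by positivity) (by positivity), Real.log_pow, Real.log_pow] at hup
  -- Since n + k ≤ n (k + 1), the lower bound n^k for the Mahler measure loses only a constant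
  -- against (n + k)^k.
  have hlog : Real.log (n + k) ≤ Real.log n + Real.log (k + 1) := by
    rw [← Real.log_mul (by positivity) (by positivity)]
    refine Real.log_le_log (by positivity) ?_
    nlinarith [(Nat.cast_nonneg k : (0 : ℝ) ≤ k)]
  have hk : (0 : ℝ) ≤ k := Nat.cast_nonneg k
  have hlog' := mul_le_mul_of_nonneg_left hlog hk
  have h3 : 0 ≤ k * Real.log 2 := by positivity
  have h4 : 0 ≤ k * Real.log ((k : ℝ) + 1) :=
    mul_nonneg hk (Real.log_nonneg (by linarith))
  have h5 : 0 ≤ Real.log k.factorial := Real.log_natCast_nonneg _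
  rw [abs_le]
  constructor <;> linarith

theorem logHeight₁_belyiCoeff_le {n : ℕ} (hn : 0 < n) (k : ℕ) :
    logHeight₁ (belyiCoeff (n + k) k k) ≤ k * Real.log (n + k) + Real.log k.factorial := by
  rw [belyiCoeff_eq hn le_rfl, div_eq_mul_inv]
  refine (logHeight₁_mul_le _ _).trans (add_le_add ?_ ?_)
  · have h : (intCoeff n k k : ℚ) ≠ 0 := by exact_mod_cast intCoeff_self_ne_zero hn k
    rw [Rat.logHeight₁_eq_log_max, Rat.num_intCast, Rat.den_intCast, ← Real.log_pow]
    have hpos : 1 ≤ (intCoeff n k k).natAbs := Int.natAbs_pos.mpr (intCoeff_self_ne_zero hn k)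
    rw [max_eq_left hpos, Nat.cast_natAbs, Int.cast_abs]
    refine Real.log_le_log (abs_pos.mpr (by exact_mod_cast h)) ?_
    simpa using abs_intCoeff_le (n := n) (le_refl k)
  · have : NeZero k.factorial := ⟨k.factorial_ne_zero⟩
    rw [logHeight₁_inv, Rat.logHeight₁_natCast]

/-- The height of a_k is at most k log d + log k!, and log d ≤ d - 1; dividing by the exponent d - 1
leaves a bound free of d. -/
theorem absLogHeight₁_le_of_pow_eq {n : ℕ} (hn : 2 ≤ n) (k : ℕ) {β : AlgebraicClosure ℚ}
    (hβ : β ^ (n + k - 1) = algebraMap ℚ (AlgebraicClosure ℚ) (belyiCoeff (n + k) k k)) :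
    absLogHeight₁ β ≤ k + Real.log k.factorial := by
  have h := logHeight₁_belyiCoeff_le (by omega : 0 < n) k
  rw [← absLogHeight₁_ratCast (Ω := AlgebraicClosure ℚ), ← eq_ratCast (algebraMap ℚ _), ← hβ, absLogHeight₁_pow,
    Nat.cast_sub (by omega)] at h
  have hn' : (2 : ℝ) ≤ n := by exact_mod_cast hn
  have hk : (0 : ℝ) ≤ k := Nat.cast_nonneg k
  have hlog : Real.log (n + k) ≤ (n + k : ℝ) - 1 := Real.log_le_sub_one_of_pos (by positivity)
  have h5 : 0 ≤ Real.log k.factorial := Real.log_natCast_nonneg _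
  push_cast at h
  have hm : (1 : ℝ) ≤ n + k - 1 := by linarith
  refine le_of_mul_le_mul_left (h.trans ?_) (by linarith : (0 : ℝ) < n + k - 1)
  nlinarith

theorem ne_zero_of_pow_eq {n : ℕ} (hn : 2 ≤ n) (k : ℕ) {β : AlgebraicClosure ℚ}
    (hβ : β ^ (n + k - 1) = algebraMap ℚ (AlgebraicClosure ℚ) (belyiCoeff (n + k) k k)) :
    β ≠ 0 := by
  rintro rfl
  rw [zero_pow (by omega), eq_comm, map_eq_zero, belyiCoeff_eq (by omega) le_rfl,
    div_eq_zero_iff] at hβ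
  rcases hβ with h | h
  · exact intCoeff_self_ne_zero (by omega : 0 < n) k (by exact_mod_cast h)
  · exact k.factorial_ne_zero (by exact_mod_cast h)

/-- The height of the conjugated Belyi polynomial up to a bounded error in its normalized form. -/
theorem abs_natDegree_mul_polyHeight_sub_le {n : ℕ} (hn : 2 ≤ n) (k : ℕ) {β : AlgebraicClosure ℚ}
    (hβ : β ^ (n + k - 1) = algebraMap ℚ (AlgebraicClosure ℚ) (belyiCoeff (n + k) k k)) :
    |((n + k : ℕ) : ℝ) * polyHeight (belyiConj (n + k) k β) - k * Real.log ((n + k : ℕ) : ℝ)| ≤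
      k * (k + Real.log k.factorial) +
        (k * Real.log 2 + k * Real.log (k + 1) + Real.log k.factorial) := by
  have hn0 : 0 < n := by omega
  have hβ0 := ne_zero_of_pow_eq hn k hβ
  have hd : ((n + k : ℕ) : ℝ) ≠ 0 := by
    rw [Nat.cast_ne_zero]
    omega
  rw [polyHeight_belyiConj hn0 k hβ0, ← mul_assoc, mul_one_div_cancel hd, one_mul]
  set s := ((intPoly n k).map (Int.castRingHom (AlgebraicClosure ℚ))).roots with hs
  -- Each of the k roots changes height by at most h(β).
  have h1 : |(s.map fun γ => absLogHeight₁ (β * γ)).sum - (s.map absLogHeight₁).sum| ≤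
      k * (k + Real.log k.factorial) := by
    rw [← Multiset.sum_map_sub]
    refine (Multiset.abs_sum_le_sum_abs).trans ?_
    rw [Multiset.map_map]
    refine (Multiset.sum_le_card_nsmul _ (k + Real.log k.factorial) fun x hx => ?_).trans_eq ?_
    · obtain ⟨γ, -, rfl⟩ := Multiset.mem_map.mp hx
      exact (abs_absLogHeight₁_mul_sub_le hβ0 γ).trans (absLogHeight₁_le_of_pow_eq hn k hβ)
    · rw [Multiset.card_map, hs, card_roots_intPoly hn0, nsmul_eq_mul]
  have h2 := abs_sum_absLogHeight₁_roots_intPoly_sub_le hn0 k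
  push_cast
  exact (abs_sub_le _ _ _).trans (add_le_add h1 h2)

end ConservativeBelyi

theorem mainTheorem3 (k : ℕ) (hk : 1 ≤ k) (β : ℕ → AlgebraicClosure ℚ)
    (hβ : ∀ d : ℕ, k + 2 ≤ d → β d ^ (d - 1) =
      algebraMap ℚ (AlgebraicClosure ℚ) (ConservativeBelyi.belyiCoeff d k k)) :
    Tendsto (fun d : ℕ => ConservativeBelyi.polyHeight
        (ConservativeBelyi.belyiConj d k (β d)) / (Real.log d / d))
      atTop (𝓝 (k : ℝ)) := by
  have hlog : Tendsto (fun d : ℕ => Real.log d) atTop atTop :=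
    Real.tendsto_log_atTop.comp tendsto_natCast_atTop_atTop
  rw [tendsto_iff_norm_sub_tendsto_zero]
  refine squeeze_zero' (Eventually.of_forall fun _ => norm_nonneg _) ?_
    -- The error is a constant depending on k alone, divided by log d.
    (hlog.const_div_atTop (k * (k + Real.log k.factorial) +
      (k * Real.log 2 + k * Real.log (k + 1) + Real.log k.factorial)))
  filter_upwards [eventually_ge_atTop (k + 2)] with d hd
  obtain ⟨n, rfl⟩ := Nat.exists_eq_add_of_le' (show k ≤ d by omega)
  have h := ConservativeBelyi.abs_natDegree_mul_polyHeight_sub_le (by omega : 2 ≤ n) k (hβ _ hd)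
  have hl : 0 < Real.log ((n + k : ℕ) : ℝ) :=
    Real.log_pos (by exact_mod_cast (by omega : 1 < n + k))
  have hd0 : ((n + k : ℕ) : ℝ) ≠ 0 := by
    rw [Nat.cast_ne_zero]
    omega
  rw [le_div_iff₀ hl, Real.norm_eq_abs]
  refine le_of_eq_of_le ?_ h
  rw [← abs_of_pos hl, ← abs_mul, abs_of_pos hl]
  congr 1
  field_simp
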